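/- For a complex Hermitian $n\times n$ matrix $M$ let $\lambda_1(M)\ge\cdots\ge\lambda_n(M)$ denote its eigenvalues, counted with multiplicity. Let $A,B$ be complex Hermitian $n\times n$ matrices, let $1\le k\le n-1$ and $1\le i_1<\cdots<i_k\le n$, and put $A(t)=A+tB$ for $t\in\mathbb R$. Then $$\sum_{j=1}^k\lambda_{i_j}(A+B)\le\sum_{j=1}^k\lambda_{i_j}(A)+\sum_{j=1}^k\lambda_j(B).$$ Equality holds if and only if there exist an integer $r\ge1$, $k$-dimensional subspaces $U_1,\dots,U_r\subseteq\mathbb C^n$ and real numbers $0=b_0<b_1<\cdots<b_r=1$ such that for each $l\in\{1,\dots,r\}$: (1) $U_l$ is invariant under both $A$ and $B$; (2) $U_l$ is spanned by orthonormal vectors $x_1,\dots,x_k$ with $Bx_j=\lambda_j(B)x_j$ for $j=1,\dots,k$; (3) for every $t\in[b_{l-1},b_l]$ the eigenvalues $\mu_{1,l}(t)\ge\cdots\ge\mu_{k,l}(t)$, counted with multiplicity, of the restriction of $A(t)$ to $U_l$ satisfy $\mu_{j,l}(t)=\lambda_{i_j}(A(t))$ for $j=1,\dots,k$. -/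

import Mathlib

namespace Wielandt

/-- The real vector space of `n × n` complex Hermitian matrices. -/
abbrev Herm (n : ℕ) := selfAdjoint (Matrix (Fin n) (Fin n) ℂ)

/-- The operator `x ↦ A x` on `ℂⁿ` with its standard Hermitian inner product. -/
noncomputable def op {n : ℕ} (A : Herm n) :
    EuclideanSpace ℂ (Fin n) →ₗ[ℂ] EuclideanSpace ℂ (Fin n) :=
  Matrix.toEuclideanLin (A : Matrix (Fin n) (Fin n) ℂ)

theorem op_isSymmetric {n : ℕ} (A : Herm n) : (op A).IsSymmetric :=
  Matrix.isSymmetric_toEuclideanLin_iff.mpr A.2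

/-- The eigenvalues of `A`, counted with multiplicity and listed in decreasing order;
`lam A j` is the `(j + 1)`-st largest eigenvalue. -/
noncomputable def lam {n : ℕ} (A : Herm n) : Fin n → ℝ :=
  (op_isSymmetric A).eigenvalues finrank_euclideanSpace_fin

/-- `U` is an invariant subspace of `A`. -/
def Invariant {n : ℕ} (A : Herm n) (U : Submodule ℂ (EuclideanSpace ℂ (Fin n))) : Prop :=
  ∀ x ∈ U, op A x ∈ U

/-- The pencil `A + t B`, for real `t`. -/
noncomputable def pencil {n : ℕ} (A B : Herm n) (t : ℝ) : Herm n := A + t • B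

theorem Invariant.pencil {n : ℕ} {A B : Herm n} {U : Submodule ℂ (EuclideanSpace ℂ (Fin n))}
    (hA : Invariant A U) (hB : Invariant B U) (t : ℝ) : Invariant (pencil A B t) U := by
  intro x hx
  have h : op (Wielandt.pencil A B t) x = op A x + (t : ℂ) • op B x := by
    ext i
    simp [op, Wielandt.pencil, Matrix.smul_mulVec]
  rw [h]
  exact U.add_mem (hA x hx) (U.smul_mem _ (hB x hx))

/-- The eigenvalues of the restriction of `A` to a `k`-dimensional invariant subspace `U`,
counted with multiplicity and listed in decreasing order. -/
noncomputable def restrictLam {n k : ℕ} (A : Herm n)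
    (U : Submodule ℂ (EuclideanSpace ℂ (Fin n))) (hU : Invariant A U)
    (hk : Module.finrank ℂ U = k) : Fin k → ℝ :=
  ((op_isSymmetric A).restrict_invariant hU).eigenvalues hk

/-- `U` is spanned by `k` orthonormal eigenvectors `x₁, …, x_k` of `B` that belong to
the `k` largest eigenvalues of `B`. -/
def SpannedByTop {n k : ℕ} (hkn : k ≤ n) (B : Herm n)
    (U : Submodule ℂ (EuclideanSpace ℂ (Fin n))) : Prop :=
  ∃ x : Fin k → EuclideanSpace ℂ (Fin n), Orthonormal ℂ x ∧
    (∀ j, op B (x j) = (lam B (Fin.castLE hkn j) : ℂ) • x j) ∧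
    Submodule.span ℂ (Set.range x) = U

end Wielandt

open Module
open scoped InnerProductSpace

namespace Wielandt

/-! ### Ky Fan's maximum principle and its equality case. -/

section KyFan

/-! The eigenvalues of `A + tB` are Lipschitz in `t`, and at almost every `t` the `i_j`-th one has
derivative `⟨x, Bx⟩`, where `x` is the `i_j`-th vector of any sorted orthonormal eigenbasis
(`deriv_eigenvalue`). By Ky Fan's principle (`sum_quad_le`) the derivative of the eigenvalue sum is
at most the sum of the `k` largest eigenvalues of `B`. Integrating over `[0, 1]` gives the
inequality.

If equality holds, Ky Fan's bound is attained at almost every `s`. There the span `U` of the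
selected eigenvectors of `A + sB` is spanned by top eigenvectors of `B` (`exists_top_eigenvectors`),
hence is invariant under `B` and under `A = (A + sB) - sB`. Off a finite set the pencil has a
constant number of distinct eigenvalues (`exists_finite_card_eq`). Between exceptional points
eigenvalue branches neither meet nor split, so the eigenvalues of the pencil on `U`, which agree
with the selected ones at `s`, agree on the whole interval (`selection_eq_of_card_image_const`), and
by continuity on its closure.

Conversely, the trace of the pencil on each `U_l` is affine in `t` with slope the top eigenvalue sum
of `B`, and the increments telescope. -/

theorem sum_castLE_eq_sum_ite {n k : ℕ} (h : k ≤ n) (c : Fin n → ℝ) :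
    ∑ j : Fin k, c (Fin.castLE h j) = ∑ i : Fin n, if (i : ℕ) < k then c i else 0 := by
  rw [← Finset.sum_filter]
  refine Finset.sum_bij (fun j _ => Fin.castLE h j) ?_ ?_ ?_ ?_
  · intro j _; simp
  · intro a _ b _ hab; exact Fin.castLE_injective h hab
  · intro i hi
    exact ⟨⟨i, by simpa using hi⟩, Finset.mem_univ _, rfl⟩
  · intro j _; rfl

/-- The deficit between the top `k` entries and a weighted sum, as a sum of nonnegative terms. -/
theorem top_sum_sub_weighted_sum {n k : ℕ} (h : k ≤ n) (c w : Fin n → ℝ) (μ : ℝ)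
    (hw : ∑ i, w i = k) :
    ∑ j : Fin k, c (Fin.castLE h j) - ∑ i, c i * w i =
      ∑ i : Fin n, (c i - μ) * ((if (i : ℕ) < k then 1 else 0) - w i) := by
  have h1 : ∑ i : Fin n, (if (i : ℕ) < k then (1 : ℝ) else 0) = k := by
    rw [← sum_castLE_eq_sum_ite h (fun _ => 1)]; simp
  rw [sum_castLE_eq_sum_ite h]
  have h2 : ∀ i : Fin n, (c i - μ) * ((if (i : ℕ) < k then 1 else 0) - w i) =
      (if (i : ℕ) < k then c i else 0) - c i * w i -
        μ * ((if (i : ℕ) < k then 1 else 0) - w i) := by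
    intro i; split_ifs <;> ring
  simp_rw [h2]
  rw [Finset.sum_sub_distrib, Finset.sum_sub_distrib, ← Finset.mul_sum, Finset.sum_sub_distrib,
    h1, hw]
  ring

/-- With the `k`-th largest entry (index `k - 1`) as threshold, both factors are nonnegative on the
first `k` indices and nonpositive afterwards. -/
theorem deficit_term_nonneg {n k : ℕ} (hk : 0 < k) (h : k ≤ n) (c w : Fin n → ℝ)
    (hc : Antitone c) (h0 : ∀ i, 0 ≤ w i) (h1 : ∀ i, w i ≤ 1) (i : Fin n) :
    0 ≤ (c i - c ⟨k - 1, by omega⟩) * ((if (i : ℕ) < k then 1 else 0) - w i) := by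
  split_ifs with hi
  · exact mul_nonneg (sub_nonneg.2 (hc (Fin.mk_le_mk.2 (by omega) : i ≤ ⟨k - 1, _⟩)))
      (sub_nonneg.2 (h1 i))
  · refine mul_nonneg_of_nonpos_of_nonpos
      (sub_nonpos.2 (hc (Fin.mk_le_mk.2 (by omega) : (⟨k - 1, _⟩ : Fin n) ≤ i))) ?_
    linarith [h0 i]

variable {E : Type*} [NormedAddCommGroup E] [InnerProductSpace ℂ E]

/-- `b` is an orthonormal basis of eigenvectors of `T`, with eigenvalues `c` in decreasing
order. -/
structure IsSortedEigenbasis {n : ℕ} (T : E →ₗ[ℂ] E) (b : OrthonormalBasis (Fin n) ℂ E)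
    (c : Fin n → ℝ) : Prop where
  antitone : Antitone c
  apply_eq : ∀ i, T (b i) = (c i : ℂ) • b i

/-- The real part of the quadratic form of `T`. -/
noncomputable def quad (T : E →ₗ[ℂ] E) (x : E) : ℝ := (⟪x, T x⟫_ℂ).re

theorem quad_add_smul (T S : E →ₗ[ℂ] E) (t : ℝ) (x : E) :
    quad (T + (t : ℂ) • S) x = quad T x + t * quad S x := by
  simp [quad]

theorem quad_eigenvector {T : E →ₗ[ℂ] E} {x : E} {c : ℝ} (hx : ‖x‖ = 1)
    (h : T x = (c : ℂ) • x) : quad T x = c := by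
  simp [quad, h, inner_self_eq_norm_sq_to_K, hx]

namespace IsSortedEigenbasis

variable {n k : ℕ} {T : E →ₗ[ℂ] E} {b : OrthonormalBasis (Fin n) ℂ E} {c : Fin n → ℝ}

theorem quad_basis (hb : IsSortedEigenbasis T b c) (i : Fin n) : quad T (b i) = c i :=
  quad_eigenvector (b.norm_eq_one i) (hb.apply_eq i)

theorem apply_eq_sum (hb : IsSortedEigenbasis T b c) (x : E) :
    T x = ∑ i, ((c i : ℂ) * ⟪b i, x⟫_ℂ) • b i := by
  conv_lhs => rw [← b.sum_repr' x]
  simp_rw [map_sum, map_smul, hb.apply_eq, smul_smul, mul_comm]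

theorem quad_eq_sum (hb : IsSortedEigenbasis T b c) (x : E) :
    quad T x = ∑ i, c i * ‖⟪b i, x⟫_ℂ‖ ^ 2 := by
  rw [quad, hb.apply_eq_sum, inner_sum, Complex.re_sum]
  refine Finset.sum_congr rfl fun i _ => ?_
  rw [inner_smul_right, mul_assoc, Complex.re_ofReal_mul, ← inner_conj_symm x (b i),
    Complex.mul_conj, Complex.normSq_eq_norm_sq, Complex.ofReal_re]

theorem sum_weight (b : OrthonormalBasis (Fin n) ℂ E) {x : Fin k → E} (hx : Orthonormal ℂ x) :
    ∑ i, ∑ j, ‖⟪b i, x j⟫_ℂ‖ ^ 2 = k := by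
  rw [Finset.sum_comm]
  simp [b.sum_sq_norm_inner_right, hx.1]

theorem weight_le_one (b : OrthonormalBasis (Fin n) ℂ E) {x : Fin k → E} (hx : Orthonormal ℂ x)
    (i : Fin n) : ∑ j, ‖⟪b i, x j⟫_ℂ‖ ^ 2 ≤ 1 := by
  have := hx.sum_inner_products_le (b i) (s := Finset.univ)
  simpa [norm_inner_symm] using this

/-- The weights sum to `k`, so the shift `μ` is free: the `k`-th eigenvalue gives Ky Fan's bound,
and `0` serves for the trace. -/
theorem deficit (hb : IsSortedEigenbasis T b c) (h : k ≤ n) {x : Fin k → E}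
    (hx : Orthonormal ℂ x) (μ : ℝ) :
    ∑ j : Fin k, c (Fin.castLE h j) - ∑ j, quad T (x j) =
      ∑ i : Fin n, (c i - μ) * ((if (i : ℕ) < k then 1 else 0) - ∑ j, ‖⟪b i, x j⟫_ℂ‖ ^ 2) := by
  rw [← top_sum_sub_weighted_sum h c _ μ (sum_weight b hx)]
  congr 1
  simp_rw [hb.quad_eq_sum, Finset.mul_sum]
  exact Finset.sum_comm

/-- Ky Fan's maximum principle. -/
theorem sum_quad_le (hb : IsSortedEigenbasis T b c) (h : k ≤ n) {x : Fin k → E}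
    (hx : Orthonormal ℂ x) :
    ∑ j, quad T (x j) ≤ ∑ j : Fin k, c (Fin.castLE h j) := by
  rcases Nat.eq_zero_or_pos k with rfl | hk
  · simp
  rw [← sub_nonneg, hb.deficit h hx (c ⟨k - 1, by omega⟩)]
  exact Finset.sum_nonneg fun i _ => deficit_term_nonneg hk h c _ hb.antitone
    (fun i => by positivity) (weight_le_one b hx) i

theorem sum_quad_eq (hb : IsSortedEigenbasis T b c) {x : Fin n → E} (hx : Orthonormal ℂ x) :
    ∑ j, quad T (x j) = ∑ j, c j := by
  have h1 : ∑ i, (1 - ∑ j, ‖⟪b i, x j⟫_ℂ‖ ^ 2) = 0 := by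
    rw [Finset.sum_sub_distrib, sum_weight b hx]; simp
  rw [Finset.sum_eq_zero_iff_of_nonneg fun i _ => sub_nonneg.2 (weight_le_one b hx i)] at h1
  have h2 := hb.deficit le_rfl hx 0
  have h3 : ∑ i : Fin n, (c i - 0) *
      ((if (i : ℕ) < n then 1 else 0) - ∑ j, ‖⟪b i, x j⟫_ℂ‖ ^ 2) = 0 :=
    Finset.sum_eq_zero fun i hi => by rw [if_pos i.2, h1 i hi, mul_zero]
  have h4 : ∑ j : Fin n, c (Fin.castLE le_rfl j) = ∑ j, c j := rfl
  linarith

/-- An orthonormal system attaining Ky Fan's bound contains, in its span, the eigenvectors whose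
eigenvalue exceeds the `k`-th one, and is orthogonal to those whose eigenvalue is below it. -/
theorem weight_of_sum_quad_eq (hb : IsSortedEigenbasis T b c) (hk : 0 < k) (h : k ≤ n)
    {x : Fin k → E} (hx : Orthonormal ℂ x)
    (heq : ∑ j, quad T (x j) = ∑ j : Fin k, c (Fin.castLE h j)) (i : Fin n) :
    (c ⟨k - 1, by omega⟩ < c i → ∑ j, ‖⟪b i, x j⟫_ℂ‖ ^ 2 = 1) ∧
      (c i < c ⟨k - 1, by omega⟩ → ∀ j, ⟪b i, x j⟫_ℂ = 0) := by
  have h0 := hb.deficit h hx (c ⟨k - 1, by omega⟩)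
  rw [heq, sub_self, eq_comm, Finset.sum_eq_zero_iff_of_nonneg
    fun i _ => deficit_term_nonneg hk h c _ hb.antitone
      (fun i => by positivity) (weight_le_one b hx) i] at h0
  have hi := h0 i (Finset.mem_univ _)
  constructor
  · intro hlt
    have hik : (i : ℕ) < k := by
      by_contra hcon
      exact absurd (hb.antitone (Fin.mk_le_mk.2 (by omega) : (⟨k - 1, by omega⟩ : Fin n) ≤ i))
        (not_le.2 hlt)
    rw [if_pos hik] at hi
    rcases mul_eq_zero.1 hi with h' | h' <;> linarith
  · intro hlt j
    have hik : ¬ (i : ℕ) < k := by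
      intro hcon
      exact absurd (hb.antitone (Fin.mk_le_mk.2 (by omega) : i ≤ (⟨k - 1, by omega⟩ : Fin n)))
        (not_le.2 hlt)
    rw [if_neg hik] at hi
    have hw : ∑ j, ‖⟪b i, x j⟫_ℂ‖ ^ 2 = 0 := by
      rcases mul_eq_zero.1 hi with h' | h' <;> linarith
    rw [Finset.sum_eq_zero_iff_of_nonneg fun _ _ => by positivity] at hw
    simpa using hw j (Finset.mem_univ _)

/-- Two sorted eigenbases have the same eigenvalues. -/
theorem eigenvalues_unique {b' : OrthonormalBasis (Fin n) ℂ E} {c' : Fin n → ℝ}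
    (hb : IsSortedEigenbasis T b c) (hb' : IsSortedEigenbasis T b' c') : c = c' := by
  -- Ky Fan for one basis, tested on the other, compares all prefix sums in both directions.
  have hle : ∀ {b b' : OrthonormalBasis (Fin n) ℂ E} {c c' : Fin n → ℝ},
      IsSortedEigenbasis T b c → IsSortedEigenbasis T b' c' → ∀ m (h : m ≤ n),
      ∑ j : Fin m, c (Fin.castLE h j) ≤ ∑ j : Fin m, c' (Fin.castLE h j) := by
    intro b b' c c' hb hb' m h
    have := hb'.sum_quad_le h (b.orthonormal.comp _ (Fin.castLE_injective h))
    simpa [hb.quad_basis] using this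
  have heq : ∀ m (h : m ≤ n),
      ∑ j : Fin m, c (Fin.castLE h j) = ∑ j : Fin m, c' (Fin.castLE h j) :=
    fun m h => le_antisymm (hle hb hb' m h) (hle hb' hb m h)
  funext i
  have h1 := heq (i + 1) i.2
  have h2 := heq i i.2.le
  rw [Fin.sum_univ_castSucc, Fin.sum_univ_castSucc] at h1
  have e : Fin.castLE i.2 (Fin.last (i : ℕ)) = i := rfl
  have e' : ∀ j : Fin (i : ℕ), Fin.castLE i.2 j.castSucc = Fin.castLE i.2.le j := fun _ => rfl
  simp only [e, e'] at h1
  linarith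

end IsSortedEigenbasis

theorem _root_.LinearMap.IsSymmetric.isSortedEigenbasis [FiniteDimensional ℂ E] {n : ℕ}
    {T : E →ₗ[ℂ] E} (hT : T.IsSymmetric) (hn : finrank ℂ E = n) :
    IsSortedEigenbasis T (hT.eigenvectorBasis hn) (hT.eigenvalues hn) :=
  ⟨hT.eigenvalues_antitone hn, hT.apply_eigenvectorBasis hn⟩

/-- If a subspace attains Ky Fan's bound, it has an orthonormal basis of eigenvectors belonging to
the `k` largest eigenvalues. -/
theorem IsSortedEigenbasis.exists_top_eigenvectors [FiniteDimensional ℂ E] {n k : ℕ}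
    {T : E →ₗ[ℂ] E} {b : OrthonormalBasis (Fin n) ℂ E} {c : Fin n → ℝ}
    (hb : IsSortedEigenbasis T b c) (hk : 0 < k) (h : k ≤ n) {x : Fin k → E}
    (hx : Orthonormal ℂ x)
    (heq : ∑ j, quad T (x j) = ∑ j : Fin k, c (Fin.castLE h j)) :
    ∃ y : Fin k → E, Orthonormal ℂ y ∧
      (∀ j, T (y j) = (c (Fin.castLE h j) : ℂ) • y j) ∧
      Submodule.span ℂ (Set.range y) = Submodule.span ℂ (Set.range x) := by
  set μ : ℝ := c ⟨k - 1, by omega⟩ with hμ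
  set U := Submodule.span ℂ (Set.range x) with hU
  have hw := hb.weight_of_sum_quad_eq hk h hx heq
  have hdim : finrank ℂ U = Fintype.card (Fin k) :=
    finrank_span_eq_card hx.linearIndependent
  -- Weight one is equality in Bessel's inequality, so `b i` coincides with its projection `p` to
  -- `U`.
  have hmem : ∀ i, μ < c i → b i ∈ U := by
    intro i hi
    have h1 := (hw i).1 hi
    set p : E := ∑ j, ⟪x j, b i⟫_ℂ • x j with hp
    have hpU : p ∈ U :=
      Submodule.sum_mem _ fun j _ => U.smul_mem _ (Submodule.subset_span ⟨j, rfl⟩)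
    have hbp : ⟪b i, p⟫_ℂ = 1 := by
      rw [hp, inner_sum]
      have : ∀ j, ⟪b i, ⟪x j, b i⟫_ℂ • x j⟫_ℂ = ((‖⟪b i, x j⟫_ℂ‖ ^ 2 : ℝ) : ℂ) := by
        intro j
        rw [inner_smul_right, ← inner_conj_symm (x j), mul_comm, Complex.mul_conj,
          Complex.normSq_eq_norm_sq]
      simp_rw [this]
      rw [← Complex.ofReal_sum, h1, Complex.ofReal_one]
    have hpp : ⟪p, p⟫_ℂ = 1 := by
      rw [hp, hx.inner_sum]
      have : ∀ j, (starRingEnd ℂ) ⟪x j, b i⟫_ℂ * ⟪x j, b i⟫_ℂ =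
          ((‖⟪b i, x j⟫_ℂ‖ ^ 2 : ℝ) : ℂ) := by
        intro j
        rw [inner_conj_symm, ← inner_conj_symm (x j), Complex.mul_conj,
          Complex.normSq_eq_norm_sq]
      simp_rw [this]
      rw [← Complex.ofReal_sum, h1, Complex.ofReal_one]
    have : b i = p := by
      rw [← sub_eq_zero, ← inner_self_eq_zero (𝕜 := ℂ), inner_sub_left, inner_sub_right,
        inner_sub_right, hbp, hpp, ← inner_conj_symm p, hbp]
      simp [inner_self_eq_norm_sq_to_K]
    rw [this]; exact hpU
  have horth : ∀ i, c i < μ → ∀ u ∈ U, ⟪b i, u⟫_ℂ = 0 := by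
    intro i hi u hu
    induction hu using Submodule.span_induction with
    | mem u hu => obtain ⟨j, rfl⟩ := hu; exact (hw i).2 hi j
    | zero => simp
    | add u v _ _ h1 h2 => rw [inner_add_right, h1, h2, add_zero]
    | smul a u _ h1 => rw [inner_smul_right, h1, mul_zero]
  -- Keep the eigenvectors strictly above `μ` and complete them inside `U`. The added vectors are
  -- orthogonal to all `b i` with `c i ≠ μ`, hence lie in the `μ`-eigenspace. The value `0` of `v`
  -- off `s` plays no role.
  let s : Set (Fin k) := {j | μ < c (Fin.castLE h j)}
  let v : Fin k → U := fun j => if hj : μ < c (Fin.castLE h j) then ⟨b _, hmem _ hj⟩ else 0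
  have hv : ∀ j ∈ s, (v j : E) = b (Fin.castLE h j) := by
    intro j hj
    have : μ < c (Fin.castLE h j) := hj
    simp [v, this]
  have hvo : Orthonormal ℂ (s.domRestrict v) := by
    have h1 : Orthonormal ℂ (fun j : s => b (Fin.castLE h j)) :=
      b.orthonormal.comp _ ((Fin.castLE_injective h).comp Subtype.val_injective)
    have h2 : (fun j : s => b (Fin.castLE h j)) = U.subtypeₗᵢ ∘ s.domRestrict v := by
      funext j; exact (hv j j.2).symm
    rw [h2] at h1
    exact (U.subtypeₗᵢ.orthonormal_comp_iff).1 h1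
  obtain ⟨y, hy⟩ := hvo.exists_orthonormalBasis_extension_of_card_eq hdim
  refine ⟨fun j => y j, y.orthonormal.comp_linearIsometry U.subtypeₗᵢ, fun j => ?_, ?_⟩
  · change T (y j : E) = (c (Fin.castLE h j) : ℂ) • (y j : E)
    by_cases hj : μ < c (Fin.castLE h j)
    · have : (y j : E) = b (Fin.castLE h j) := by rw [hy j hj, hv j hj]
      rw [this]; exact hb.apply_eq _
    · have hcj : c (Fin.castLE h j) = μ :=
        le_antisymm (not_lt.1 hj) (hb.antitone (Fin.mk_le_mk.2 (by have := j.2; omega)))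
      rw [hcj, hb.apply_eq_sum]
      conv_rhs => rw [← b.sum_repr' (y j : E)]
      rw [Finset.smul_sum]
      refine Finset.sum_congr rfl fun i _ => ?_
      rw [smul_smul]
      rcases lt_trichotomy (c i) μ with hi | hi | hi
      · simp [horth i hi _ (y j).2]
      · rw [hi]
      · have hik : (i : ℕ) < k := by
          by_contra hcon
          exact absurd (hb.antitone (Fin.mk_le_mk.2 (by omega) : (⟨k - 1, by omega⟩ : Fin n) ≤ i))
            (not_le.2 hi)
        have hne : (⟨i, hik⟩ : Fin k) ≠ j := by
          rintro rfl
          exact hj hi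
        have hyi : (y ⟨i, hik⟩ : E) = b i := by
          rw [hy ⟨i, hik⟩ hi, hv ⟨i, hik⟩ hi]; rfl
        have : ⟪b i, (y j : E)⟫_ℂ = 0 := by
          rw [← hyi]; exact y.orthonormal.2 hne
        simp [this]
  · have h1 := y.toBasis.span_eq
    have h2 : Set.range (fun j => (y j : E)) = U.subtype '' Set.range y.toBasis := by
      rw [← Set.range_comp]; congr 1
    rw [h2, Submodule.span_image, h1, Submodule.map_top, Submodule.range_subtype]

end KyFan

/-! ### Regularity and derivatives of the eigenvalues along a pencil. -/

section Curves

variable {E : Type*} [NormedAddCommGroup E] [InnerProductSpace ℂ E] {n : ℕ}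
  {T S : E →ₗ[ℂ] E} {b : ℝ → OrthonormalBasis (Fin n) ℂ E} {c : ℝ → Fin n → ℝ}

theorem exists_abs_quad_le [FiniteDimensional ℂ E] (S : E →ₗ[ℂ] E) :
    ∃ K : ℝ, 0 ≤ K ∧ ∀ x, ‖x‖ = 1 → |quad S x| ≤ K := by
  refine ⟨‖LinearMap.toContinuousLinearMap S‖, norm_nonneg _, fun x hx => ?_⟩
  refine (Complex.abs_re_le_norm _).trans ((norm_inner_le_norm _ _).trans ?_)
  have := (LinearMap.toContinuousLinearMap S).le_opNorm x
  simpa [hx] using this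

/-- Sums of the largest eigenvalues along a pencil have subgradients given by eigenvectors. -/
theorem prefix_sum_subgradient (hbc : ∀ t : ℝ, IsSortedEigenbasis (T + (t : ℂ) • S) (b t) (c t))
    {m : ℕ} (h : m ≤ n) (s t : ℝ) :
    ∑ j : Fin m, c s (Fin.castLE h j) + (t - s) * ∑ j : Fin m, quad S (b s (Fin.castLE h j)) ≤
      ∑ j : Fin m, c t (Fin.castLE h j) := by
  -- Ky Fan at parameter `t` is tested on the eigenvectors belonging to `s`.
  have h1 := (hbc t).sum_quad_le h ((b s).orthonormal.comp _ (Fin.castLE_injective h))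
  refine le_of_eq_of_le ?_ h1
  rw [Finset.mul_sum, ← Finset.sum_add_distrib]
  refine Finset.sum_congr rfl fun j _ => ?_
  have h2 := (hbc s).quad_basis (Fin.castLE h j)
  rw [quad_add_smul] at h2
  simp only [Function.comp_apply]
  rw [quad_add_smul, ← h2]
  ring

theorem eq_prefix_sum_sub (c : Fin n → ℝ) (i : Fin n) :
    c i = ∑ j : Fin (i + 1), c (Fin.castLE i.2 j) -
      ∑ j : Fin (i : ℕ), c (Fin.castLE i.2.le j) := by
  rw [Fin.sum_univ_castSucc]
  have e : Fin.castLE i.2 (Fin.last (i : ℕ)) = i := rfl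
  have e' : ∀ j : Fin (i : ℕ), Fin.castLE i.2 j.castSucc = Fin.castLE i.2.le j := fun _ => rfl
  simp only [e, e']
  ring

/-- The subgradients of a prefix sum are bounded by `n * K`, and an eigenvalue is a difference of
two prefix sums, whence the constant `2 * (n * K)`. -/
theorem exists_lipschitzWith_eigenvalues [FiniteDimensional ℂ E]
    (hbc : ∀ t : ℝ, IsSortedEigenbasis (T + (t : ℂ) • S) (b t) (c t)) :
    ∃ K : NNReal, ∀ i, LipschitzWith K fun t => c t i := by
  obtain ⟨K, hK0, hK⟩ := exists_abs_quad_le S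
  have hlow : ∀ m (h : m ≤ n) s t,
      ∑ j : Fin m, c s (Fin.castLE h j) - ∑ j : Fin m, c t (Fin.castLE h j) ≤
        n * K * |t - s| := by
    intro m h s t
    have h1 := prefix_sum_subgradient hbc h s t
    have h2 : |∑ j : Fin m, quad S (b s (Fin.castLE h j))| ≤ n * K := by
      refine (Finset.abs_sum_le_sum_abs _ _).trans
        ((Finset.sum_le_card_nsmul _ _ K fun j _ => hK _ ((b s).norm_eq_one _)).trans ?_)
      rw [Finset.card_univ, Fintype.card_fin, nsmul_eq_mul]
      gcongr
    have h3 := neg_abs_le ((t - s) * ∑ j : Fin m, quad S (b s (Fin.castLE h j)))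
    rw [abs_mul] at h3
    nlinarith [abs_nonneg (t - s)]
  refine ⟨(2 * (n * K)).toNNReal, fun i => LipschitzWith.of_dist_le_mul fun s t => ?_⟩
  rw [Real.dist_eq, Real.dist_eq, Real.coe_toNNReal _ (by positivity), eq_prefix_sum_sub (c s) i,
    eq_prefix_sum_sub (c t) i, abs_le]
  have h1 := hlow _ i.2 s t
  have h2 := hlow _ i.2 t s
  have h3 := hlow _ i.2.le s t
  have h4 := hlow _ i.2.le t s
  rw [abs_sub_comm t s] at h1 h3
  constructor <;> linarith

/-- Where all eigenvalues of a pencil are differentiable, their derivatives are given by first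
order perturbation theory, for any choice of the eigenvectors. -/
theorem deriv_eigenvalue (hbc : ∀ t : ℝ, IsSortedEigenbasis (T + (t : ℂ) • S) (b t) (c t)) {s : ℝ}
    (hd : ∀ i, DifferentiableAt ℝ (fun t => c t i) s) (i : Fin n) :
    deriv (fun t => c t i) s = quad S (b s i) := by
  have key : ∀ m (h : m ≤ n), ∑ j : Fin m, deriv (fun t => c t (Fin.castLE h j)) s =
      ∑ j : Fin m, quad S (b s (Fin.castLE h j)) := by
    intro m h
    set D := ∑ j : Fin m, quad S (b s (Fin.castLE h j)) with hD
    have h1 : HasDerivAt (fun t => ∑ j : Fin m, c t (Fin.castLE h j))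
        (∑ j : Fin m, deriv (fun t => c t (Fin.castLE h j)) s) s :=
      HasDerivAt.fun_sum fun j _ => (hd _).hasDerivAt
    have h2 := h1.sub (((hasDerivAt_id s).sub_const s).mul_const D)
    -- The prefix sum lies above its supporting line and touches it at `s`, so the two slopes agree.
    have hmin : IsLocalMin ((fun t => ∑ j : Fin m, c t (Fin.castLE h j)) -
        fun t => (id t - s) * D) s := by
      refine Filter.Eventually.of_forall fun t => ?_
      have := prefix_sum_subgradient hbc h s t
      simp only [Pi.sub_apply, id, sub_self, zero_mul, sub_zero]
      linarith
    have := hmin.hasDerivAt_eq_zero h2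
    linarith
  rw [eq_prefix_sum_sub (fun i => deriv (fun t => c t i) s) i,
    eq_prefix_sum_sub (fun i => quad S (b s i)) i, key, key]

end Curves

/-! ### Rigidity of continuous selections from the spectrum. -/

section Clusters

/-- Along a preconnected set on which the number of distinct values of a continuous family is
constant, a continuous selection that once agrees with a member of the family does so always. -/
theorem selection_eq_of_card_image_const {X : Type*} [TopologicalSpace X] {n d : ℕ}
    {c : X → Fin n → ℝ} {μ : X → ℝ} (hc : ∀ i, Continuous fun t => c t i) (hμ : Continuous μ)
    {J : Set X} (hJo : IsOpen J)
    (hJ : IsPreconnected J) (hd : ∀ t ∈ J, (Finset.univ.image (c t)).card = d)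
    (hsel : ∀ t ∈ J, ∃ i, μ t = c t i) {s : X} (hs : s ∈ J) {i : Fin n} (hsi : μ s = c s i) :
    ∀ t ∈ J, μ t = c t i := by
  have hcl : IsClosed {t | μ t = c t i} := isClosed_eq hμ (hc i)
  have hloc : ∀ t ∈ J, μ t = c t i → ∀ᶠ u in nhds t, μ u = c u i := by
    intro t ht hti
    have h1 : ∀ᶠ u in nhds t, ∀ p q, c t p ≠ c t q → c u p ≠ c u q := by
      simp only [Filter.eventually_all]
      intro p q hpq
      exact ((hc p).continuousAt.ne_iff_eventually_ne (hc q).continuousAt).1 hpq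
    have h2 : ∀ᶠ u in nhds t, ∀ p, μ t ≠ c t p → μ u ≠ c u p := by
      simp only [Filter.eventually_all]
      intro p hp
      exact (hμ.continuousAt.ne_iff_eventually_ne (hc p).continuousAt).1 hp
    filter_upwards [h1, h2, hJo.mem_nhds ht] with u hu1 hu2 huJ
    obtain ⟨p, hp⟩ := hsel u huJ
    have hp' : c t p = c t i := by
      rw [← hti]
      by_contra hne
      exact hu2 p (Ne.symm hne) hp
    -- Distinct values at `t` stay distinct at nearby `u`, so `c u q ↦ c t q` is a well-defined
    -- surjection `g` of value sets. Equal cardinality makes it injective: values that coincide at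
    -- `t` still coincide at `u`.
    have hfac : ∀ x ∈ Finset.univ.image (c u), ∃ y, ∀ q, c u q = x → c t q = y := by
      intro x hx
      obtain ⟨q, -, rfl⟩ := Finset.mem_image.1 hx
      exact ⟨c t q, fun r hr => by
        by_contra hne
        exact hu1 r q hne hr⟩
    choose! g hg using hfac
    have hg' : ∀ q, g (c u q) = c t q := fun q =>
      (hg _ (Finset.mem_image_of_mem _ (Finset.mem_univ q)) q rfl).symm
    have himg : (Finset.univ.image (c u)).image g = Finset.univ.image (c t) := by
      rw [Finset.image_image]
      congr 1
      funext q
      exact hg' q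
    have hinj : Set.InjOn g (Finset.univ.image (c u)) := by
      rw [← Finset.card_image_iff, himg, hd t ht, hd u huJ]
    rw [hp]
    refine hinj (by simp) (by simp) ?_
    rw [hg', hg', hp']
  -- The agreement set is closed, and open within `J` by `hloc`.
  have hsub := hJ.subset_of_closure_inter_subset (u := interior {t | μ t = c t i})
    isOpen_interior ⟨s, hs, mem_interior_iff_mem_nhds.2 (hloc s hs hsi)⟩ fun t ht =>
      mem_interior_iff_mem_nhds.2
        (hloc t ht.2 (closure_minimal interior_subset hcl ht.1))
  intro t ht
  exact interior_subset (s := {t | μ t = c t i}) (hsub ht)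

end Clusters

/-! ### The generic number of distinct eigenvalues. -/

section DistinctEigenvalues

variable {E : Type*} [NormedAddCommGroup E] [InnerProductSpace ℂ E] {n : ℕ}

/-- Symmetry moves the outermost factor of the power onto `y`, so the induction must leave `y` free.
-/
theorem exists_polynomial_inner_pow {T S : E →ₗ[ℂ] E} (hT : T.IsSymmetric) (hS : S.IsSymmetric)
    (v : E) (j : ℕ) (y : E) : ∃ p : Polynomial ℂ, ∀ t : ℝ,
      ⟪y, ((T + (t : ℂ) • S) ^ j) v⟫_ℂ = p.eval (t : ℂ) := by
  induction j generalizing y with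
  | zero => exact ⟨Polynomial.C ⟪y, v⟫_ℂ, by simp⟩
  | succ j ih =>
    obtain ⟨p, hp⟩ := ih (T y)
    obtain ⟨q, hq⟩ := ih (S y)
    refine ⟨p + Polynomial.X * q, fun t => ?_⟩
    rw [pow_succ', Module.End.mul_apply, LinearMap.add_apply, LinearMap.smul_apply,
      inner_add_right, inner_smul_right, ← hT, ← hS, hp, hq]
    simp

theorem IsSortedEigenbasis.pow_apply {T : E →ₗ[ℂ] E} {b : OrthonormalBasis (Fin n) ℂ E}
    {c : Fin n → ℝ} (hb : IsSortedEigenbasis T b c) (j : ℕ) (i : Fin n) :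
    (T ^ j) (b i) = ((c i : ℂ) ^ j) • b i := by
  induction j with
  | zero => simp
  | succ j ih => rw [pow_succ', Module.End.mul_apply, ih, map_smul, hb.apply_eq, smul_smul, pow_succ]

/-- An operator with fewer than `m` distinct eigenvalues satisfies a nontrivial polynomial relation
of degree less than `m`. -/
theorem IsSortedEigenbasis.exists_relation {T : E →ₗ[ℂ] E} {b : OrthonormalBasis (Fin n) ℂ E}
    {c : Fin n → ℝ} (hb : IsSortedEigenbasis T b c) {m : ℕ}
    (hm : (Finset.univ.image c).card < m) :
    ∃ a : Fin m → ℂ, a ≠ 0 ∧ ∀ v, ∑ j : Fin m, a j • (T ^ (j : ℕ)) v = 0 := by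
  -- One factor per distinct eigenvalue: `P` annihilates `T`, and its leading coefficient `1` makes
  -- the relation nontrivial.
  let P : Polynomial ℂ := ∏ x ∈ Finset.univ.image c, (Polynomial.X - Polynomial.C (x : ℂ))
  have hP : P.Monic := Polynomial.monic_prod_X_sub_C _ _
  have hdeg : P.natDegree = (Finset.univ.image c).card :=
    Polynomial.natDegree_finsetProd_X_sub_C_eq_card _ _
  have hroot : ∀ i, P.eval (c i : ℂ) = 0 := by
    intro i
    rw [Polynomial.eval_prod]
    exact Finset.prod_eq_zero (Finset.mem_image_of_mem c (Finset.mem_univ i)) (by simp)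
  refine ⟨fun j => P.coeff j, fun h0 => ?_, fun v => ?_⟩
  · have h1 := congrFun h0 ⟨P.natDegree, by omega⟩
    have h2 : P.coeff P.natDegree = 1 := hP
    simp only [Pi.zero_apply] at h1
    rw [h1] at h2
    exact zero_ne_one h2
  · have h1 : ∀ i, ∑ j : Fin m, P.coeff j • (T ^ (j : ℕ)) (b i) = 0 := by
      intro i
      simp_rw [hb.pow_apply, smul_smul]
      rw [← Finset.sum_smul, Fin.sum_univ_eq_sum_range (fun j => P.coeff j * (c i : ℂ) ^ j),
        ← Polynomial.eval_eq_sum_range' (by omega), hroot, zero_smul]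
    have h2 : (∑ j : Fin m, P.coeff j • (T ^ (j : ℕ))) = 0 := by
      refine b.toBasis.ext fun i => ?_
      simpa [LinearMap.sum_apply] using h1 i
    have := LinearMap.congr_fun h2 v
    simpa [LinearMap.sum_apply] using this

/-- Having at least `m` distinct eigenvalues is a generic property in a pencil. -/
theorem finite_card_lt {T S : E →ₗ[ℂ] E} (hT : T.IsSymmetric) (hS : S.IsSymmetric)
    {b : ℝ → OrthonormalBasis (Fin n) ℂ E} {c : ℝ → Fin n → ℝ}
    (hbc : ∀ t : ℝ, IsSortedEigenbasis (T + (t : ℂ) • S) (b t) (c t)) (s : ℝ) :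
    {t : ℝ | (Finset.univ.image (c t)).card < (Finset.univ.image (c s)).card}.Finite := by
  obtain ⟨m, hm⟩ : ∃ m, m = (Finset.univ.image (c s)).card := ⟨_, rfl⟩
  rw [← hm]
  let e := (Finset.univ.image (c s)).equivFinOfCardEq hm.symm
  have hσ : ∀ l : Fin m, ∃ i, c s i = (e.symm l : ℝ) := fun l => by
    obtain ⟨i, -, hi⟩ := Finset.mem_image.1 (e.symm l).2
    exact ⟨i, hi⟩
  choose σ hσ using hσ
  have hinj : Function.Injective fun l => (c s (σ l) : ℂ) := by
    intro l l' h
    have h' : c s (σ l) = c s (σ l') := Complex.ofReal_injective h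
    rw [hσ, hσ] at h'
    exact e.symm.injective (Subtype.ext h')
  have hσinj : Function.Injective σ := fun l l' h => hinj (by simp [h])
  -- One eigenvector at `s` for each distinct eigenvalue. The coordinates of `v, Tₜv, …, Tₜ^(m-1)v`,
  -- with `Tₜ = T + tS`, along these vectors form a matrix polynomial in `t`, which at `t = s` is
  -- Vandermonde with distinct nodes. Fewer than `m` distinct eigenvalues at `t` make its columns
  -- dependent, so `t` is a root of the determinant.
  let v : E := ∑ l, b s (σ l)
  choose p hp using fun j l : Fin m => exists_polynomial_inner_pow hT hS v j (b s (σ l))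
  let M : Matrix (Fin m) (Fin m) (Polynomial ℂ) := Matrix.of fun l j => p j l
  have hM : ∀ t : ℝ, M.det.eval (t : ℂ) = (Matrix.of fun l j : Fin m =>
      ⟪b s (σ l), ((T + (t : ℂ) • S) ^ (j : ℕ)) v⟫_ℂ).det := by
    intro t
    have := (Polynomial.evalRingHom (t : ℂ)).map_det M
    rw [Polynomial.coe_evalRingHom] at this
    rw [this]
    congr 1
    ext l j
    simpa [M] using (hp j l t).symm
  have hne : M.det ≠ 0 := by
    intro h0
    have h1 := hM s
    rw [h0, Polynomial.eval_zero] at h1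
    have h2 : (Matrix.of fun l j : Fin m =>
        ⟪b s (σ l), ((T + (s : ℂ) • S) ^ (j : ℕ)) v⟫_ℂ) =
        Matrix.vandermonde fun l => (c s (σ l) : ℂ) := by
      ext l j
      simp only [Matrix.of_apply, Matrix.vandermonde_apply, v, map_sum, (hbc s).pow_apply,
        inner_sum, inner_smul_right]
      rw [Finset.sum_eq_single l]
      · simp [inner_self_eq_norm_sq_to_K]
      · intro l' _ hl'
        rw [(b s).orthonormal.2 (fun h => hl' (hσinj h).symm), mul_zero]
      · simp
    rw [h2] at h1
    exact Matrix.det_vandermonde_ne_zero_iff.2 hinj h1.symm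
  refine Set.Finite.subset
    ((M.det.roots.toFinset.finite_toSet).preimage Complex.ofReal_injective.injOn) ?_
  intro t ht
  obtain ⟨a, ha0, ha⟩ := (hbc t).exists_relation ht
  simp only [Set.mem_preimage, Finset.mem_coe, Multiset.mem_toFinset]
  rw [Polynomial.mem_roots hne, Polynomial.IsRoot, hM]
  refine Matrix.exists_mulVec_eq_zero_iff.1 ⟨a, ha0, ?_⟩
  funext l
  have := congrArg (fun u => ⟪b s (σ l), u⟫_ℂ) (ha v)
  simpa [Matrix.mulVec, dotProduct, inner_sum, inner_smul_right, mul_comm] using this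

/-- The number of distinct eigenvalues of a pencil is constant off a finite set. -/
theorem exists_finite_card_eq {T S : E →ₗ[ℂ] E} (hT : T.IsSymmetric) (hS : S.IsSymmetric)
    {b : ℝ → OrthonormalBasis (Fin n) ℂ E} {c : ℝ → Fin n → ℝ}
    (hbc : ∀ t : ℝ, IsSortedEigenbasis (T + (t : ℂ) • S) (b t) (c t)) :
    ∃ (d : ℕ) (Z : Set ℝ), Z.Finite ∧ ∀ t ∉ Z, (Finset.univ.image (c t)).card = d := by
  have hbdd : BddAbove (Set.range fun t => (Finset.univ.image (c t)).card) :=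
    ⟨n, by rintro _ ⟨t, rfl⟩; simpa using Finset.card_image_le (s := Finset.univ) (f := c t)⟩
  -- Take `s` where the number of distinct eigenvalues is maximal.
  obtain ⟨s, hs⟩ := Nat.sSup_mem (Set.range_nonempty _) hbdd
  refine ⟨_, _, finite_card_lt hT hS hbc s, fun t ht => le_antisymm ?_ (not_lt.1 ht)⟩
  have hs' : (Finset.univ.image (c s)).card = _ := hs
  rw [hs']
  exact le_csSup hbdd ⟨t, rfl⟩

end DistinctEigenvalues

/-! ### Integration along the pencil. -/

section Integration

variable {E : Type*} [NormedAddCommGroup E] [InnerProductSpace ℂ E] [FiniteDimensional ℂ E]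
  {n k : ℕ} {T S : E →ₗ[ℂ] E} {b : ℝ → OrthonormalBasis (Fin n) ℂ E} {c : ℝ → Fin n → ℝ}
  {bS : OrthonormalBasis (Fin n) ℂ E} {cS : Fin n → ℝ}

theorem exists_lipschitzWith_sum (hbc : ∀ t : ℝ, IsSortedEigenbasis (T + (t : ℂ) • S) (b t) (c t))
    (i : Fin k → Fin n) : ∃ K : NNReal, LipschitzWith K fun t => ∑ j, c t (i j) := by
  obtain ⟨K, hK⟩ := exists_lipschitzWith_eigenvalues hbc
  refine ⟨∑ _j : Fin k, K, LipschitzWith.of_dist_le_mul fun s t => ?_⟩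
  refine (dist_sum_sum_le _ _ _).trans ?_
  rw [NNReal.coe_sum, Finset.sum_mul]
  exact Finset.sum_le_sum fun j _ => (hK (i j)).dist_le_mul s t

theorem ae_deriv_sum (hbc : ∀ t : ℝ, IsSortedEigenbasis (T + (t : ℂ) • S) (b t) (c t))
    (i : Fin k → Fin n) :
    ∀ᵐ t : ℝ, deriv (fun t => ∑ j, c t (i j)) t = ∑ j, quad S (b t (i j)) := by
  obtain ⟨K, hK⟩ := exists_lipschitzWith_eigenvalues hbc
  have h1 : ∀ᵐ t : ℝ, ∀ p, DifferentiableAt ℝ (fun t => c t p) t :=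
    MeasureTheory.ae_all_iff.2 fun p => (hK p).ae_differentiableAt_real
  filter_upwards [h1] with t ht
  rw [deriv_fun_sum fun j _ => ht (i j)]
  exact Finset.sum_congr rfl fun j _ => deriv_eigenvalue hbc ht (i j)

/-- Lipschitz functions are absolutely continuous, so the fundamental theorem of calculus applies.
-/
theorem intervalIntegrable_deriv_sum
    (hbc : ∀ t : ℝ, IsSortedEigenbasis (T + (t : ℂ) • S) (b t) (c t)) (i : Fin k → Fin n) :
    IntervalIntegrable (deriv fun t => ∑ j, c t (i j)) MeasureTheory.volume 0 1 ∧
      ∫ t in (0 : ℝ)..1, deriv (fun t => ∑ j, c t (i j)) t =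
        ∑ j, c 1 (i j) - ∑ j, c 0 (i j) := by
  obtain ⟨K, hK⟩ := exists_lipschitzWith_sum hbc i
  have hac := (hK.lipschitzOnWith (s := Set.uIcc 0 1)).absolutelyContinuousOnInterval
  exact ⟨hac.intervalIntegrable_deriv, hac.integral_deriv_eq_sub⟩

/-- The Lidskii–Wielandt inequality. -/
theorem sum_eigenvalues_le (hbc : ∀ t : ℝ, IsSortedEigenbasis (T + (t : ℂ) • S) (b t) (c t))
    (hS : IsSortedEigenbasis S bS cS) (hkn : k ≤ n) {i : Fin k → Fin n}
    (hi : Function.Injective i) :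
    ∑ j, c 1 (i j) ≤ ∑ j, c 0 (i j) + ∑ j : Fin k, cS (Fin.castLE hkn j) := by
  obtain ⟨h1, h2⟩ := intervalIntegrable_deriv_sum hbc i
  have h3 := intervalIntegral.integral_mono_ae zero_le_one h1
    (intervalIntegrable_const (c := ∑ j : Fin k, cS (Fin.castLE hkn j))) (by
      filter_upwards [ae_deriv_sum hbc i] with t ht
      rw [ht]
      exact hS.sum_quad_le hkn ((b t).orthonormal.comp _ hi))
  rw [h2] at h3
  simp only [intervalIntegral.integral_const, sub_zero, one_smul] at h3
  linarith

/-- Equality makes the integral of the almost everywhere nonnegative Ky Fan deficit vanish, so the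
deficit is zero almost everywhere. -/
theorem ae_sum_quad_eq (hbc : ∀ t : ℝ, IsSortedEigenbasis (T + (t : ℂ) • S) (b t) (c t))
    (hS : IsSortedEigenbasis S bS cS) (hkn : k ≤ n) {i : Fin k → Fin n}
    (hi : Function.Injective i)
    (heq : ∑ j, c 1 (i j) = ∑ j, c 0 (i j) + ∑ j : Fin k, cS (Fin.castLE hkn j)) :
    ∀ᵐ t : ℝ, t ∈ Set.Ioc (0 : ℝ) 1 →
      ∑ j, quad S (b t (i j)) = ∑ j : Fin k, cS (Fin.castLE hkn j) := by
  obtain ⟨h1, h2⟩ := intervalIntegrable_deriv_sum hbc i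
  set C := ∑ j : Fin k, cS (Fin.castLE hkn j) with hC
  have h3 : ∫ t in (0 : ℝ)..1, (C - deriv (fun t => ∑ j, c t (i j)) t) = 0 := by
    rw [intervalIntegral.integral_sub intervalIntegrable_const h1, h2, heq]
    simp
  have hder := ae_deriv_sum hbc i
  rw [intervalIntegral.integral_eq_zero_iff_of_le_of_nonneg_ae zero_le_one
    (MeasureTheory.ae_restrict_of_ae (by
      filter_upwards [hder] with t ht
      rw [ht]
      exact sub_nonneg.2 (hS.sum_quad_le hkn ((b t).orthonormal.comp _ hi))))
    (intervalIntegrable_const.sub h1), Filter.EventuallyEq,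
    MeasureTheory.ae_restrict_iff' measurableSet_Ioc] at h3
  filter_upwards [h3, hder] with t ht hdt htI
  have h4 := ht htI
  rw [hdt] at h4
  exact (sub_eq_zero.1 h4).symm

end Integration

/-- The nodes are `0`, `1` and the points of `Z` strictly between them, in increasing order. -/
theorem exists_partition {Z : Set ℝ} (hZ : Z.Finite) :
    ∃ (r : ℕ) (b : Fin (r + 1) → ℝ), StrictMono b ∧ b 0 = 0 ∧ b (Fin.last r) = 1 ∧
      ∀ l : Fin r, ∀ t ∈ Set.Ioo (b l.castSucc) (b l.succ), t ∉ Z := by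
  classical
  let F : Finset ℝ := insert 0 (insert 1 (hZ.toFinset.filter fun t => 0 < t ∧ t < 1))
  have h0 : (0 : ℝ) ∈ F := by simp [F]
  have h1 : (1 : ℝ) ∈ F := by simp [F]
  have hF : ∀ t ∈ F, 0 ≤ t ∧ t ≤ 1 := by
    intro t ht
    simp only [F, Finset.mem_insert, Finset.mem_filter] at ht
    rcases ht with rfl | rfl | ⟨-, h, h'⟩
    · simp
    · simp
    · exact ⟨h.le, h'.le⟩
  obtain ⟨r, hr⟩ : ∃ r, F.card = r + 1 :=
    Nat.exists_eq_succ_of_ne_zero (Finset.card_ne_zero_of_mem h0)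
  have hmono := (F.orderEmbOfFin hr).strictMono
  have hsurj : ∀ t ∈ F, ∃ m, F.orderEmbOfFin hr m = t := by
    intro t ht
    have : t ∈ Set.range (F.orderEmbOfFin hr) := by rw [Finset.range_orderEmbOfFin]; exact ht
    exact this
  refine ⟨r, F.orderEmbOfFin hr, hmono, ?_, ?_, ?_⟩
  · obtain ⟨m, hm⟩ := hsurj 0 h0
    exact le_antisymm (hm ▸ hmono.monotone (Fin.zero_le m))
      (hF _ (F.orderEmbOfFin_mem hr 0)).1
  · obtain ⟨m, hm⟩ := hsurj 1 h1
    refine le_antisymm (hF _ (F.orderEmbOfFin_mem hr _)).2 ?_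
    have := hmono.monotone (Fin.le_last m)
    rwa [hm] at this
  · intro l t ht htZ
    have htF : t ∈ F := by
      have := (hF _ (F.orderEmbOfFin_mem hr l.castSucc)).1
      have := (hF _ (F.orderEmbOfFin_mem hr l.succ)).2
      simp only [F, Finset.mem_insert, Finset.mem_filter, Set.Finite.mem_toFinset]
      exact Or.inr (Or.inr ⟨htZ, by linarith [ht.1], by linarith [ht.2]⟩)
    obtain ⟨m, rfl⟩ := hsurj t htF
    have ha := hmono.lt_iff_lt.1 ht.1
    have hb := hmono.lt_iff_lt.1 ht.2
    rw [Fin.lt_def] at ha hb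
    simp at ha hb
    omega

/-! ### Common invariant subspaces of Hermitian matrices. -/

section Pencil

variable {n k : ℕ} {A B : Herm n}

theorem op_pencil (A B : Herm n) (t : ℝ) : op (pencil A B t) = op A + (t : ℂ) • op B := by
  ext x i
  simp [op, pencil, Matrix.smul_mulVec]

theorem lam_eigenbasis (A : Herm n) : IsSortedEigenbasis (op A)
    ((op_isSymmetric A).eigenvectorBasis finrank_euclideanSpace_fin) (lam A) :=
  (op_isSymmetric A).isSortedEigenbasis _

theorem pencil_eigenbasis (A B : Herm n) (t : ℝ) : IsSortedEigenbasis (op A + (t : ℂ) • op B)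
    ((op_isSymmetric (pencil A B t)).eigenvectorBasis finrank_euclideanSpace_fin)
    (lam (pencil A B t)) := by
  rw [← op_pencil]
  exact lam_eigenbasis _

variable {U : Submodule ℂ (EuclideanSpace ℂ (Fin n))}

theorem restrictLam_eigenbasis (hA : Invariant A U) (hk : finrank ℂ U = k) :
    IsSortedEigenbasis ((op A).restrict hA)
      (((op_isSymmetric A).restrict_invariant hA).eigenvectorBasis hk) (restrictLam A U hA hk) :=
  ((op_isSymmetric A).restrict_invariant hA).isSortedEigenbasis hk

theorem restrict_pencil (hA : Invariant A U) (hB : Invariant B U) (t : ℝ) :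
    (op (pencil A B t)).restrict (hA.pencil hB t) =
      (op A).restrict hA + (t : ℂ) • (op B).restrict hB := by
  ext1 x
  refine Subtype.ext ?_
  change op (pencil A B t) x = op A x + (t : ℂ) • op B x
  rw [op_pencil, LinearMap.add_apply, LinearMap.smul_apply]

theorem continuous_lam (A B : Herm n) (i : Fin n) : Continuous fun t => lam (pencil A B t) i := by
  obtain ⟨K, hK⟩ := exists_lipschitzWith_eigenvalues (pencil_eigenbasis A B)
  exact (hK i).continuous

theorem continuous_restrictLam (hA : Invariant A U) (hB : Invariant B U) (hk : finrank ℂ U = k)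
    (j : Fin k) : Continuous fun t => restrictLam (pencil A B t) U (hA.pencil hB t) hk j := by
  obtain ⟨K, hK⟩ := exists_lipschitzWith_eigenvalues (E := U)
    (T := (op A).restrict hA) (S := (op B).restrict hB)
    (c := fun t => restrictLam (pencil A B t) U (hA.pencil hB t) hk) fun t => by
      rw [← restrict_pencil]
      exact restrictLam_eigenbasis (hA.pencil hB t) hk
  exact (hK j).continuous

theorem exists_restrictLam_eq (hA : Invariant A U) (hk : finrank ℂ U = k) (j : Fin k) :
    ∃ i, restrictLam A U hA hk j = lam A i := by
  have hb := restrictLam_eigenbasis hA hk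
  set y := ((op_isSymmetric A).restrict_invariant hA).eigenvectorBasis hk
  have h1 : op A (y j) = (restrictLam A U hA hk j : ℂ) • (y j : EuclideanSpace ℂ (Fin n)) :=
    congrArg Subtype.val (hb.apply_eq j)
  have h2 : (y j : EuclideanSpace ℂ (Fin n)) ≠ 0 := fun h0 => by
    have h3 := y.norm_eq_one j
    rw [← Submodule.norm_coe, h0, norm_zero] at h3
    exact zero_ne_one h3
  have h3 : End.HasEigenvalue (op A) (restrictLam A U hA hk j : ℂ) :=
    End.hasEigenvalue_of_hasEigenvector ⟨End.mem_eigenspace_iff.2 h1, h2⟩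
  obtain ⟨i, hi⟩ := (op_isSymmetric A).exists_eigenvalues_eq finrank_euclideanSpace_fin h3
  exact ⟨i, (Complex.ofReal_injective hi).symm⟩

/-- The eigenvalues of the restriction to the span of some eigenvectors. -/
theorem restrictLam_eq_of_eigenvectors (hA : Invariant A U) (hk : finrank ℂ U = k)
    {x : Fin k → EuclideanSpace ℂ (Fin n)} (hx : Orthonormal ℂ x) (hxU : ∀ j, x j ∈ U)
    {c : Fin k → ℝ} (hc : Antitone c) (hxc : ∀ j, op A (x j) = (c j : ℂ) • x j) :
    restrictLam A U hA hk = c := by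
  let v : Fin k → U := fun j => ⟨x j, hxU j⟩
  have hv : Orthonormal ℂ v :=
    U.subtypeₗᵢ.orthonormal_comp_iff.1 (show Orthonormal ℂ (U.subtypeₗᵢ ∘ v) from hx)
  -- The system already has `k = dim U` members, so the extension only repackages `v` as an
  -- orthonormal basis.
  obtain ⟨y, hy⟩ := (hv.comp _ Subtype.val_injective :
    Orthonormal ℂ (Set.univ.domRestrict v)).exists_orthonormalBasis_extension_of_card_eq
      (by simpa using hk)
  refine (restrictLam_eigenbasis hA hk).eigenvalues_unique (b' := y) ⟨hc, fun j => ?_⟩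
  rw [hy j (Set.mem_univ j)]
  exact Subtype.ext (hxc j)

theorem invariant_span {x : Fin k → EuclideanSpace ℂ (Fin n)}
    (h : ∀ j, op A (x j) ∈ Submodule.span ℂ (Set.range x)) :
    Invariant A (Submodule.span ℂ (Set.range x)) := by
  have : Submodule.span ℂ (Set.range x) ≤ (Submodule.span ℂ (Set.range x)).comap (op A) := by
    rw [Submodule.span_le]
    rintro _ ⟨j, rfl⟩
    exact h j
  exact this

theorem SpannedByTop.invariant {hkn : k ≤ n} (h : SpannedByTop hkn B U) : Invariant B U := by
  obtain ⟨x, -, hx, rfl⟩ := h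
  refine invariant_span fun j => ?_
  rw [hx j]
  exact Submodule.smul_mem _ _ (Submodule.subset_span ⟨j, rfl⟩)

/-- The trace of the pencil on a top invariant subspace of `B` is affine, of known slope. -/
theorem SpannedByTop.exists_sum_restrictLam {hkn : k ≤ n} (h : SpannedByTop hkn B U)
    (hA : Invariant A U) (hB : Invariant B U) (hk : finrank ℂ U = k) : ∃ a : ℝ, ∀ t : ℝ,
      ∑ j, restrictLam (pencil A B t) U (hA.pencil hB t) hk j =
        a + t * ∑ j : Fin k, lam B (Fin.castLE hkn j) := by
  obtain ⟨x, hx, hxB, hspan⟩ := h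
  have hxU : ∀ j, x j ∈ U := fun j => hspan ▸ Submodule.subset_span ⟨j, rfl⟩
  refine ⟨∑ j, quad (op A) (x j), fun t => ?_⟩
  let v : Fin k → U := fun j => ⟨x j, hxU j⟩
  have hv : Orthonormal ℂ v := U.subtypeₗᵢ.orthonormal_comp_iff.1 (show Orthonormal ℂ (U.subtypeₗᵢ ∘ v) from hx)
  -- The trace is computed in the fixed eigenvectors `x` of `B`, which do not depend on `t`.
  rw [← (restrictLam_eigenbasis (hA.pencil hB t) hk).sum_quad_eq hv, Finset.mul_sum,
    ← Finset.sum_add_distrib]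
  refine Finset.sum_congr rfl fun j _ => ?_
  have h1 : quad ((op (pencil A B t)).restrict (hA.pencil hB t)) (v j) =
      quad (op (pencil A B t)) (x j) := rfl
  rw [h1, op_pencil, quad_add_smul, quad_eigenvector (hx.1 j) (hxB j)]

/-- On an interval on which the number of distinct eigenvalues of the pencil is constant, extremal
growth of the eigenvalue sum is explained by one common invariant subspace. -/
theorem exists_subspace_of_card_const (hk : 0 < k) (hkn : k ≤ n) {i : Fin k → Fin n}
    (hi : StrictMono i) {p q : ℝ} {d : ℕ}
    (hd : ∀ t ∈ Set.Ioo p q, (Finset.univ.image (lam (pencil A B t))).card = d) {s : ℝ}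
    (hs : s ∈ Set.Ioo p q)
    (hquad : ∑ j, quad (op B)
      ((op_isSymmetric (pencil A B s)).eigenvectorBasis finrank_euclideanSpace_fin (i j)) =
        ∑ j : Fin k, lam B (Fin.castLE hkn j)) :
    ∃ (U : Submodule ℂ (EuclideanSpace ℂ (Fin n))) (hA : Invariant A U) (hB : Invariant B U)
      (hdim : finrank ℂ U = k), SpannedByTop hkn B U ∧
        ∀ t ∈ Set.Icc p q, ∀ j : Fin k,
          restrictLam (pencil A B t) U (hA.pencil hB t) hdim j = lam (pencil A B t) (i j) := by
  have hbs := lam_eigenbasis (pencil A B s)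
  set e := (op_isSymmetric (pencil A B s)).eigenvectorBasis finrank_euclideanSpace_fin
  have hx : Orthonormal ℂ fun j => e (i j) := e.orthonormal.comp _ hi.injective
  have htop : SpannedByTop hkn B (Submodule.span ℂ (Set.range fun j => e (i j))) :=
    (lam_eigenbasis B).exists_top_eigenvectors hk hkn hx hquad
  have hB := htop.invariant
  have hmem : ∀ j, e (i j) ∈ Submodule.span ℂ (Set.range fun j => e (i j)) :=
    fun j => Submodule.subset_span ⟨j, rfl⟩
  have hA : Invariant A (Submodule.span ℂ (Set.range fun j => e (i j))) := by
    refine invariant_span fun j => ?_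
    have h1 := hbs.apply_eq (i j)
    rw [op_pencil, LinearMap.add_apply, LinearMap.smul_apply] at h1
    rw [eq_sub_of_add_eq h1]
    exact Submodule.sub_mem _ (Submodule.smul_mem _ _ (hmem j))
      (Submodule.smul_mem _ _ (hB _ (hmem j)))
  have hdim : finrank ℂ (Submodule.span ℂ (Set.range fun j => e (i j))) = k := by
    simpa using finrank_span_eq_card hx.linearIndependent
  refine ⟨_, hA, hB, hdim, htop, fun t ht j => ?_⟩
  -- Agreement at `s` holds because `U` is spanned by the selected eigenvectors there; it is then
  -- propagated over `(p, q)`.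
  have hs' : restrictLam (pencil A B s) _ (hA.pencil hB s) hdim =
      fun j => lam (pencil A B s) (i j) :=
    restrictLam_eq_of_eigenvectors _ hdim hx hmem
      (hbs.antitone.comp_monotone hi.monotone) fun j => hbs.apply_eq (i j)
  have hopen := selection_eq_of_card_image_const (continuous_lam A B)
    (continuous_restrictLam hA hB hdim j) isOpen_Ioo isPreconnected_Ioo hd
    (fun t _ => exists_restrictLam_eq _ hdim j) hs (congrFun hs' j)
  have hcl : IsClosed {t | restrictLam (pencil A B t) _ (hA.pencil hB t) hdim j =
      lam (pencil A B t) (i j)} :=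
    isClosed_eq (continuous_restrictLam hA hB hdim j) (continuous_lam A B (i j))
  rw [← closure_Ioo (hs.1.trans hs.2).ne] at ht
  exact closure_minimal hopen hcl ht

end Pencil

end Wielandt

/-- The condition `r ≥ 1` is automatic: for `r = 0` the nodes `b 0` and `b (Fin.last r)` coincide
and cannot be both `0` and `1`. -/
theorem theorem3p1 {n k : ℕ} (hk : 1 ≤ k) (hkn : k < n) (A B : Wielandt.Herm n)
    (i : Fin k → Fin n) (hi : StrictMono i) :
    (∑ j, Wielandt.lam (A + B) (i j) ≤
      ∑ j, Wielandt.lam A (i j) + ∑ j : Fin k, Wielandt.lam B (Fin.castLE hkn.le j)) ∧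
    ((∑ j, Wielandt.lam (A + B) (i j) =
      ∑ j, Wielandt.lam A (i j) + ∑ j : Fin k, Wielandt.lam B (Fin.castLE hkn.le j)) ↔
      ∃ (r : ℕ) (U : Fin r → Submodule ℂ (EuclideanSpace ℂ (Fin n)))
        (hA : ∀ l, Wielandt.Invariant A (U l)) (hB : ∀ l, Wielandt.Invariant B (U l))
        (hdim : ∀ l, Module.finrank ℂ (U l) = k),
        (∀ l, Wielandt.SpannedByTop hkn.le B (U l)) ∧
        ∃ b : Fin (r + 1) → ℝ, StrictMono b ∧ b 0 = 0 ∧ b (Fin.last r) = 1 ∧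
          ∀ l : Fin r, ∀ t ∈ Set.Icc (b l.castSucc) (b l.succ), ∀ j : Fin k,
            Wielandt.restrictLam (Wielandt.pencil A B t) (U l)
                ((hA l).pencil (hB l) t) (hdim l) j =
              Wielandt.lam (Wielandt.pencil A B t) (i j)) := by
  have hp0 : Wielandt.pencil A B 0 = A := by simp [Wielandt.pencil]
  have hp1 : Wielandt.pencil A B 1 = A + B := by simp [Wielandt.pencil]
  have hbc := Wielandt.pencil_eigenbasis A B
  refine ⟨?_, fun heq => ?_, ?_⟩
  · have := Wielandt.sum_eigenvalues_le hbc (Wielandt.lam_eigenbasis B) hkn.le hi.injective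
    rwa [hp0, hp1] at this
  · obtain ⟨d, Z, hZ, hd⟩ := Wielandt.exists_finite_card_eq (Wielandt.op_isSymmetric A)
      (Wielandt.op_isSymmetric B) hbc
    obtain ⟨r, b, hb, hb0, hb1, hbZ⟩ := Wielandt.exists_partition hZ
    have hae := Wielandt.ae_sum_quad_eq hbc (Wielandt.lam_eigenbasis B) hkn.le hi.injective
      (by rwa [hp0, hp1])
    have hgood : ∀ l : Fin r, ∃ s ∈ Set.Ioo (b l.castSucc) (b l.succ), s ∈ Set.Ioc (0 : ℝ) 1 ∧
        (s ∈ Set.Ioc (0 : ℝ) 1 → _) := fun l => by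
      -- A set of full measure is dense, so every open piece contains a parameter attaining Ky Fan's
      -- bound.
      obtain ⟨s, hsI, hs⟩ := (MeasureTheory.Measure.dense_of_ae hae).exists_mem_open isOpen_Ioo
        (Set.nonempty_Ioo.2 (hb l.castSucc_lt_succ))
      have h0 : 0 ≤ b l.castSucc := hb0 ▸ hb.monotone (Fin.zero_le _)
      have h1 : b l.succ ≤ 1 := hb1 ▸ hb.monotone (Fin.le_last _)
      exact ⟨s, hs, ⟨h0.trans_lt hs.1, hs.2.le.trans h1⟩, hsI⟩
    choose s hsI hs hquad using hgood
    have hpiece := fun l => Wielandt.exists_subspace_of_card_const hk hkn.le hi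
      (fun t ht => hd t (hbZ l t ht)) (hsI l) (hquad l (hs l))
    choose U hA hB hdim htop hU using hpiece
    exact ⟨r, U, hA, hB, hdim, htop, b, hb, hb0, hb1, hU⟩
  · rintro ⟨r, U, hA, hB, hdim, htop, b, hbmono, hb0, hb1, hU⟩
    -- Each node lies in both adjacent closed pieces, so the affine increments add up from `0` to
    -- `1`.
    have haff : ∀ m : Fin (r + 1), ∑ j, Wielandt.lam (Wielandt.pencil A B (b m)) (i j) =
        ∑ j, Wielandt.lam A (i j) + b m * ∑ j : Fin k, Wielandt.lam B (Fin.castLE hkn.le j) := by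
      intro m
      induction m using Fin.induction with
      | zero => rw [hb0, hp0, zero_mul, add_zero]
      | succ l ih =>
        have hle : b l.castSucc ≤ b l.succ := hbmono.monotone l.castSucc_lt_succ.le
        obtain ⟨a, ha⟩ := (htop l).exists_sum_restrictLam (hA l) (hB l) (hdim l)
        have h1 := ha (b l.castSucc)
        have h2 := ha (b l.succ)
        simp_rw [hU l _ (Set.left_mem_Icc.2 hle)] at h1
        simp_rw [hU l _ (Set.right_mem_Icc.2 hle)] at h2
        linarith
    have := haff (Fin.last r)
    rwa [hb1, hp1, one_mul] at this
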